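/- A map $f:X\to Y$ of topological spaces is $F_\sigma$-measurable if the preimage of every open set is a countable union of closed sets, Darboux if it maps connected sets to connected sets, and Baire-one if it is the pointwise limit of a sequence of continuous maps $X\to Y$. There exist a connected subset $Y\subseteq\mathbb R^2$ and an $F_\sigma$-measurable Darboux map $f:\mathbb R\to Y$ that is not Baire-one. More precisely, let $(r_n)_{n\ge 1}$ be any enumeration of the rationals, i.e. $\mathbb Q=\{r_n:n\ge 1\}$ (repetitions are allowed). Put $\varphi_n(x)=\sin\frac1{x-r_n}$ for $x\ne r_n$ and $\varphi_n(r_n)=0$, let $g(x)=\sum_{n=1}^\infty 2^{-n}\varphi_n(x)$ for $x\in\mathbb R$ (the series converges for every $x$), let $Y=\{(x,y)\in\mathbb R^2: y=g(x)\}$ be the graph of $g$, and let $f:\mathbb R\to Y$, $f(x)=(x,g(x))$. Then $Y$ is connected, $f$ is $F_\sigma$-measurable and Darboux, and $f$ is not Baire-one. Moreover, $Y$ is punctiform (it contains no compact connected set with more than one point), and every continuous map $\mathbb R\to Y$ is constant. -/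

import Mathlib

/-!
Subtracting from `g` the multiple of `φ_q` with coefficient the total weight at `q` leaves a
function continuous at `q`. Hence `g` is continuous off the rationals, which gives
`F_σ`-measurability, and since `φ_q` vanishes at points arbitrarily close to `q` on both sides,
`(q, g q)` is a limit of points of the graph from the left and from the right. If the image of an
interval under the graph map were split by two open sets, the boundary between their preimages
would be closed, countable and nonempty, and by the two-sided limits it would have no isolated
point; the Baire category theorem forbids this, so the graph map is Darboux.

On the other hand `φ_q` also takes the value `1` arbitrarily close to `q`, so `g` is discontinuous
on a dense set, whereas a compact subset of the graph whose projection contains an interval would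
make `g` continuous on that interval. So the graph is punctiform, continuous maps from the line
into it are constant, and so are their pointwise limits.
-/

open Filter Topology

namespace GraphExample

/-- An `F_σ`-set: a countable union of closed sets. -/
def IsFSigma {X : Type*} [TopologicalSpace X] (s : Set X) : Prop :=
  ∃ F : ℕ → Set X, (∀ n, IsClosed (F n)) ∧ s = ⋃ n, F n

/-- `F_σ`-measurability: preimages of open sets are `F_σ`-sets. -/
def FSigmaMeasurable {X Y : Type*} [TopologicalSpace X] [TopologicalSpace Y]
    (f : X → Y) : Prop :=
  ∀ V : Set Y, IsOpen V → IsFSigma (f ⁻¹' V)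

/-- Darboux mappings: images of connected sets are connected. -/
def IsDarboux {X Y : Type*} [TopologicalSpace X] [TopologicalSpace Y] (f : X → Y) : Prop :=
  ∀ C : Set X, IsConnected C → IsConnected (f '' C)

/-- Baire-one mappings: pointwise limits of sequences of continuous mappings `X → Y`. -/
def IsBaireOne {X Y : Type*} [TopologicalSpace X] [TopologicalSpace Y] (f : X → Y) : Prop :=
  ∃ F : ℕ → X → Y, (∀ n, Continuous (F n)) ∧ ∀ x, Tendsto (fun n => F n x) atTop (𝓝 (f x))

/-- A subset of a Hausdorff space is punctiform if it contains no continuum (compact connected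
set) with more than one point. -/
def IsPunctiform {X : Type*} [TopologicalSpace X] [T2Space X] (Y : Set X) : Prop :=
  ∀ K : Set X, K ⊆ Y → IsCompact K → IsConnected K → K.Subsingleton

/-- The function `x ↦ sin (1 / (x - a))`, with value `0` at `a`. -/
noncomputable def phi (a x : ℝ) : ℝ :=
  if x = a then 0 else Real.sin (1 / (x - a))

/-- `g(x) = ∑_{n ≥ 1} 2⁻ⁿ φ_n(x)`; here the `n`-th rational, `n ≥ 1`, is `r (n - 1)`. -/
noncomputable def g (r : ℕ → ℚ) (x : ℝ) : ℝ :=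
  ∑' n : ℕ, 1 / 2 ^ (n + 1) * phi (r n) x

/-- The graph of a real function, as a subset of the plane. -/
def graph (u : ℝ → ℝ) : Set (ℝ × ℝ) := {p | p.2 = u p.1}

/-- The graph map `x ↦ (x, u x)`, as a map from the line into the graph. -/
def graphMap (u : ℝ → ℝ) (x : ℝ) : graph u := ⟨(x, u x), rfl⟩

end GraphExample

namespace GraphExample

open Set

section FSigma

variable {X Y : Type*} [TopologicalSpace X] [TopologicalSpace Y]

theorem isFSigma_iff_isGδ_compl {s : Set X} : IsFSigma s ↔ IsGδ sᶜ := by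
  rw [isGδ_iff_eq_iInter_nat]
  constructor
  · rintro ⟨F, hF, rfl⟩
    exact ⟨fun n => (F n)ᶜ, fun n => (hF n).isOpen_compl, compl_iUnion F⟩
  · rintro ⟨G, hG, hs⟩
    exact ⟨fun n => (G n)ᶜ, fun n => (hG n).isClosed_compl, by
      rw [← compl_iInter, ← hs, compl_compl]⟩

theorem fSigmaMeasurable_of_countable_not_continuousAt [PerfectlyNormalSpace X] [T1Space X]
    {f : X → Y} (hf : {x | ¬ContinuousAt f x}.Countable) : FSigmaMeasurable f := by
  intro V hV
  have hcover : f ⁻¹' V = interior (f ⁻¹' V) ∪ f ⁻¹' V ∩ {x | ¬ContinuousAt f x} := by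
    refine Subset.antisymm (fun x hx => ?_) (union_subset interior_subset inter_subset_left)
    by_cases hfx : ContinuousAt f x
    · exact Or.inl (mem_interior_iff_mem_nhds.2 (hfx (hV.mem_nhds hx)))
    · exact Or.inr ⟨hx, hfx⟩
  rw [hcover, isFSigma_iff_isGδ_compl, compl_union]
  exact isOpen_interior.isClosed_compl.isGδ.inter (hf.mono inter_subset_right).isGδ_compl

end FSigma

section BilaterallyDense

theorem inter_frontier_nonempty_of_isPreconnected {X : Type*} [TopologicalSpace X] {J A : Set X}
    (hJ : IsPreconnected J) (hA : (J ∩ A).Nonempty) (hAc : (J ∩ Aᶜ).Nonempty) :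
    (J ∩ frontier A).Nonempty := by
  rw [frontier_eq_closure_inter_closure]
  refine isPreconnected_closed_iff.1 hJ _ _ isClosed_closure isClosed_closure (fun x _ => ?_)
    (hA.mono (inter_subset_inter_right _ subset_closure))
    (hAc.mono (inter_subset_inter_right _ subset_closure))
  exact (em (x ∈ A)).imp (fun h => subset_closure h) (fun h => subset_closure h)

theorem eq_empty_of_perfect_of_countable {X : Type*} [TopologicalSpace X] [T2Space X]
    [LocallyCompactSpace X] {C : Set X} (hC : Perfect C) (hcount : C.Countable) : C = ∅ := by
  by_contra hne
  have := hC.closed.isClosedEmbedding_subtypeVal.locallyCompactSpace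
  have := hcount.to_subtype
  have := (nonempty_iff_ne_empty.2 hne).to_subtype
  obtain ⟨x, y, hy⟩ := nonempty_interior_of_iUnion_of_closed
    (f := fun x : C => ({x} : Set C)) (fun x => isClosed_singleton)
    (eq_univ_of_forall fun x => mem_iUnion.2 ⟨x, rfl⟩)
  obtain ⟨U, hU, hUx⟩ := mem_nhds_subtype C y {x} |>.1 (mem_interior_iff_mem_nhds.1 hy)
  obtain ⟨z, ⟨hzU, hzC⟩, hzy⟩ := preperfect_iff_nhds.1 hC.acc y y.2 U hU
  have hzx : (⟨z, hzC⟩ : C) = x := hUx hzU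
  have hyx : y ∈ ({x} : Set C) := interior_subset hy
  exact hzy (congrArg Subtype.val (hzx.trans (mem_singleton_iff.1 hyx).symm))

/-- A set in a linear order is bilaterally dense in itself if each of its points is a limit, from
the left and from the right, of other points of the set. The condition is phrased with open
intervals so that it asks nothing on the outer side of an endpoint of the order. -/
def BilaterallyDense {α : Type*} [LinearOrder α] (A : Set α) : Prop :=
  ∀ x ∈ A, (∀ y > x, (Ioo x y ∩ A).Nonempty) ∧ ∀ y < x, (Ioo y x ∩ A).Nonempty

namespace BilaterallyDense

theorem preimage_val {α : Type*} [LinearOrder α] {A : Set α} (hA : BilaterallyDense A)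
    (I : Set α) [I.OrdConnected] : BilaterallyDense ((↑) ⁻¹' A : Set I) := by
  refine fun x hx => ⟨fun y hy => ?_, fun y hy => ?_⟩
  · obtain ⟨z, hz, hzA⟩ := (hA x hx).1 y hy
    exact ⟨⟨z, Set.Icc_subset I x.2 y.2 (Ioo_subset_Icc_self hz)⟩, hz, hzA⟩
  · obtain ⟨z, hz, hzA⟩ := (hA x hx).2 y hy
    exact ⟨⟨z, Set.Icc_subset I y.2 x.2 (Ioo_subset_Icc_self hz)⟩, hz, hzA⟩

variable {α : Type*} [ConditionallyCompleteLinearOrder α] [DenselyOrdered α] [TopologicalSpace α]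
  [OrderTopology α] {A : Set α}

theorem accPt_frontier (hA : BilaterallyDense A) {x : α} (hxA : x ∈ A) (hx : x ∈ frontier A) :
    AccPt x (𝓟 (frontier A)) := by
  refine accPt_iff_nhds.2 fun U hU => ?_
  obtain ⟨b, c, -, hbc, hbcU⟩ := exists_Icc_mem_subset_of_mem_nhds hU
  obtain ⟨y, hy, hyA⟩ : (Icc b c ∩ Aᶜ).Nonempty :=
    mem_closure_iff_nhds.1 (frontier_eq_closure_inter_closure.subset hx).2 _ hbc
  have hxbc : x ∈ Icc b c := mem_of_mem_nhds hbc
  obtain ⟨z, hzA, hz, hxzy⟩ : ∃ z ∈ A, z ∈ Icc b c ∧ x ∉ uIcc z y := by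
    rcases lt_or_gt_of_ne (ne_of_mem_of_not_mem hxA hyA) with hxy | hyx
    · obtain ⟨z, hz, hzA⟩ := (hA x hxA).1 y hxy
      exact ⟨z, hzA, ordConnected_Icc.out hxbc hy (Ioo_subset_Icc_self hz),
        notMem_uIcc_of_lt hz.1 hxy⟩
    · obtain ⟨z, hz, hzA⟩ := (hA x hxA).2 y hyx
      exact ⟨z, hzA, ordConnected_Icc.out hy hxbc (Ioo_subset_Icc_self hz),
        notMem_uIcc_of_gt hz.2 hyx⟩
  obtain ⟨w, hw, hwA⟩ := inter_frontier_nonempty_of_isPreconnected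
    (isPreconnected_uIcc (a := z) (b := y)) ⟨z, left_mem_uIcc, hzA⟩ ⟨y, right_mem_uIcc, hyA⟩
  exact ⟨w, ⟨hbcU (ordConnected_Icc.uIcc_subset hz hy hw), hwA⟩, ne_of_mem_of_not_mem hw hxzy⟩

theorem perfect_frontier (hA : BilaterallyDense A) (hAc : BilaterallyDense Aᶜ) :
    Perfect (frontier A) := by
  refine ⟨isClosed_frontier, fun x hx => ?_⟩
  by_cases hxA : x ∈ A
  · exact hA.accPt_frontier hxA hx
  · rw [← frontier_compl] at hx ⊢
    exact hAc.accPt_frontier hxA hx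

theorem eq_empty_or_univ [LocallyCompactSpace α] (hA : BilaterallyDense A)
    (hAc : BilaterallyDense Aᶜ) (hcount : (frontier A).Countable) : A = ∅ ∨ A = univ :=
  frontier_eq_empty_iff.1 (eq_empty_of_perfect_of_countable (hA.perfect_frontier hAc) hcount)

end BilaterallyDense

end BilaterallyDense

section Darboux

variable {α Y : Type*} [ConditionallyCompleteLinearOrder α] [DenselyOrdered α]
  [TopologicalSpace α] [OrderTopology α] [TopologicalSpace Y] {f : α → Y}

theorem isPreconnected_range_of_bilaterallyDense [LocallyCompactSpace α]
    (hcount : {x | ¬ContinuousAt f x}.Countable)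
    (hf : ∀ V, IsOpen V → BilaterallyDense (f ⁻¹' V)) : IsPreconnected (range f) := by
  refine isPreconnected_iff_subset_of_disjoint.2 fun U V hU hV hcover hdisj => ?_
  have hcompl : f ⁻¹' V = (f ⁻¹' U)ᶜ := by
    ext x
    have := hcover (mem_range_self x)
    have : f x ∉ U ∩ V := fun h => hdisj.subset ⟨mem_range_self x, h⟩
    grind
  have hfrontier : frontier (f ⁻¹' U) ⊆ {x | ¬ContinuousAt f x} := by
    rintro x hx hfx
    rw [frontier_eq_inter_compl_interior, ← hcompl] at hx
    rcases hcover (mem_range_self x) with hxU | hxV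
    · exact hx.1 (mem_interior_iff_mem_nhds.2 (hfx (hU.mem_nhds hxU)))
    · exact hx.2 (mem_interior_iff_mem_nhds.2 (hfx (hV.mem_nhds hxV)))
  rcases (hf U hU).eq_empty_or_univ (hcompl ▸ hf V hV) (hcount.mono hfrontier) with hA | hA
  · rw [hA, compl_empty] at hcompl
    exact Or.inr (range_subset_iff.2 (eq_univ_iff_forall.1 hcompl))
  · exact Or.inl (range_subset_iff.2 (eq_univ_iff_forall.1 hA))

theorem isPreconnected_image_Icc_of_bilaterallyDense (hcount : {x | ¬ContinuousAt f x}.Countable)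
    (hf : ∀ V, IsOpen V → BilaterallyDense (f ⁻¹' V)) (a b : α) :
    IsPreconnected (f '' Icc a b) := by
  rcases (Icc a b).eq_empty_or_nonempty with hab | ⟨x, hx⟩
  · simp only [hab, image_empty, isPreconnected_empty]
  have : Inhabited (Icc a b) := ⟨x, hx⟩
  rw [image_eq_range]
  refine isPreconnected_range_of_bilaterallyDense (f := fun x : Icc a b => f x)
    ((hcount.preimage Subtype.val_injective).mono ?_) fun V hV => (hf V hV).preimage_val _
  exact fun y hy hfy => hy (ContinuousAt.comp hfy continuousAt_subtype_val)

theorem isDarboux_of_bilaterallyDense (hcount : {x | ¬ContinuousAt f x}.Countable)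
    (hf : ∀ V, IsOpen V → BilaterallyDense (f ⁻¹' V)) : IsDarboux f := by
  refine fun C hC => ⟨hC.nonempty.image f, isPreconnected_of_forall_pair ?_⟩
  rintro _ ⟨x, hx, rfl⟩ _ ⟨y, hy, rfl⟩
  exact ⟨f '' uIcc x y, image_mono (hC.isPreconnected.ordConnected.uIcc_subset hx hy),
    mem_image_of_mem f left_mem_uIcc, mem_image_of_mem f right_mem_uIcc,
    isPreconnected_image_Icc_of_bilaterallyDense hcount hf _ _⟩

end Darboux

namespace IsPunctiform

variable {X Z : Type*} [TopologicalSpace X] [T2Space X] [TopologicalSpace Z]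
  [PathConnectedSpace Z] {Y : Set X}

theorem eq_of_continuous (hY : IsPunctiform Y) {h : Z → Y} (hh : Continuous h) (s t : Z) :
    h s = h t := by
  let γ : Path s t := PathConnectedSpace.somePath s t
  have hc : Continuous fun x => (h (γ x) : X) := by fun_prop
  refine Subtype.ext (hY (range fun x => (h (γ x) : X))
    (range_subset_iff.2 fun x => (h (γ x)).2) (isCompact_range hc) (isConnected_range hc)
    ⟨0, ?_⟩ ⟨1, ?_⟩)
  · simp only [γ.source]
  · simp only [γ.target]

theorem eq_of_isBaireOne (hY : IsPunctiform Y) {f : Z → Y} (hf : IsBaireOne f) (s t : Z) :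
    f s = f t := by
  obtain ⟨F, hF, hlim⟩ := hf
  exact tendsto_nhds_unique (hlim s) ((hlim t).congr fun n => hY.eq_of_continuous (hF n) t s)

end IsPunctiform

section Graph

variable {u : ℝ → ℝ}

theorem continuousAt_graphMap {x : ℝ} (hu : ContinuousAt u x) : ContinuousAt (graphMap u) x :=
  tendsto_subtype_rng.2 (continuousAt_id.prodMk hu)

theorem countable_not_continuousAt_graphMap (hu : {x | ¬ContinuousAt u x}.Countable) :
    {x | ¬ContinuousAt (graphMap u) x}.Countable :=
  hu.mono fun _ hx hux => hx (continuousAt_graphMap hux)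

theorem range_graphMap (u : ℝ → ℝ) : range (graphMap u) = univ :=
  eq_univ_of_forall fun p => ⟨p.1.1, Subtype.ext (Prod.ext rfl p.2.symm)⟩

theorem isConnected_graph_of_isDarboux (hu : IsDarboux (graphMap u)) : IsConnected (graph u) := by
  have huniv := hu univ isConnected_univ
  rw [image_univ, range_graphMap] at huniv
  exact isConnected_iff_connectedSpace.2 (connectedSpace_iff_univ.2 huniv)

theorem continuousOn_image_fst_of_isCompact {K : Set (ℝ × ℝ)} (hK : IsCompact K)
    (hKu : K ⊆ graph u) : ContinuousOn u (Prod.fst '' K) := by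
  refine continuousOn_iff_isClosed.2 fun C hC => ⟨Prod.fst '' (K ∩ Prod.snd ⁻¹' C),
    ((hK.inter_right (hC.preimage continuous_snd)).image continuous_fst).isClosed, ?_⟩
  ext x
  constructor
  · rintro ⟨hxC, p, hp, rfl⟩
    have hpC : p.2 ∈ C := (hKu hp).symm ▸ hxC
    exact ⟨⟨p, ⟨hp, hpC⟩, rfl⟩, p, hp, rfl⟩
  · rintro ⟨⟨p, ⟨hp, hpC⟩, rfl⟩, hx⟩
    exact ⟨Eq.subst (motive := (· ∈ C)) (hKu hp) hpC, hx⟩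

theorem isPunctiform_graph_of_dense_not_continuousAt (hu : Dense {x | ¬ContinuousAt u x}) :
    IsPunctiform (graph u) := by
  intro K hKu hKcomp hKconn p hp q hq
  by_contra hpq
  have hfst : p.1 ≠ q.1 := fun h =>
    hpq (Prod.ext h ((hKu hp).trans ((congrArg u h).trans (hKu hq).symm)))
  have hord : (Prod.fst '' K).OrdConnected :=
    (hKconn.isPreconnected.image _ continuous_fst.continuousOn).ordConnected
  have hsub : Ioo (min p.1 q.1) (max p.1 q.1) ⊆ Prod.fst '' K :=
    Ioo_subset_Icc_self.trans
      (hord.uIcc_subset (mem_image_of_mem _ hp) (mem_image_of_mem _ hq))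
  obtain ⟨x, hx, hux⟩ := hu.inter_open_nonempty _ isOpen_Ioo (nonempty_Ioo.2 (inf_lt_sup.2 hfst))
  exact hux ((continuousOn_image_fst_of_isCompact hKcomp hKu).continuousAt
    (mem_of_superset (isOpen_Ioo.mem_nhds hx) hsub))

theorem not_isBaireOne_graphMap (hu : IsPunctiform (graph u)) : ¬IsBaireOne (graphMap u) :=
  fun h => zero_ne_one (congrArg (fun p => p.1.1) (hu.eq_of_isBaireOne h 0 1))

end Graph

section Phi

theorem abs_phi_le_one (a x : ℝ) : |phi a x| ≤ 1 := by
  unfold phi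
  split_ifs
  · exact abs_zero.trans_le zero_le_one
  · exact Real.abs_sin_le_one _

theorem phi_self (a : ℝ) : phi a a = 0 :=
  if_pos rfl

-- At `t = 0` both sides are `0`, since `0⁻¹ = 0`.
theorem phi_add_inv (a t : ℝ) : phi a (a + t⁻¹) = Real.sin t := by
  by_cases ht : t = 0 <;> simp [phi, ht]

theorem continuousAt_phi {a x : ℝ} (hx : x ≠ a) : ContinuousAt (phi a) x := by
  have hsin : ContinuousAt (fun y => Real.sin (1 / (y - a))) x :=
    Real.continuous_sin.continuousAt.comp
      (continuousAt_const.div (by fun_prop) (sub_ne_zero.2 hx))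
  refine hsin.congr ?_
  filter_upwards [isOpen_ne.mem_nhds hx] with y hy
  exact (if_neg hy).symm

end Phi

section Oscillation

/-- `u` oscillates at `b` with amplitude `w` if it differs from `w * phi b` by a function
continuous at `b`. -/
def HasOscillation (u : ℝ → ℝ) (w b : ℝ) : Prop :=
  ContinuousAt (fun x => u x - w * phi b x) b

namespace HasOscillation

variable {u : ℝ → ℝ} {w b : ℝ}

theorem tendsto {κ : Type*} {l : Filter κ} {t : κ → ℝ} {s : ℝ} (hu : HasOscillation u w b)
    (ht : Tendsto (fun k => b + (t k)⁻¹) l (𝓝 b)) (hs : ∀ k, Real.sin (t k) = s) :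
    Tendsto (fun k => u (b + (t k)⁻¹)) l (𝓝 (u b + w * s)) := by
  have hlim := (ContinuousAt.tendsto hu).comp ht |>.add_const (w * s)
  simpa only [Function.comp_def, phi_add_inv, hs, phi_self, mul_zero, sub_zero, sub_add_cancel]
    using hlim

theorem continuousAt_iff (hu : HasOscillation u w b) : ContinuousAt u b ↔ w = 0 := by
  constructor
  · intro hcont
    let t : ℕ → ℝ := fun k => Real.pi / 2 + k * (2 * Real.pi)
    have htop : Tendsto t atTop atTop := tendsto_atTop_add_const_left _ _
      (tendsto_natCast_atTop_atTop.atTop_mul_const Real.two_pi_pos)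
    have ht : Tendsto (fun k => b + (t k)⁻¹) atTop (𝓝 b) := by
      simpa only [Function.comp_apply, add_zero]
        using (tendsto_inv_atTop_zero.comp htop).const_add b
    have hsin (k : ℕ) : Real.sin (t k) = 1 := by
      rw [Real.sin_add_nat_mul_two_pi, Real.sin_pi_div_two]
    have hlim : u b = u b + w * 1 :=
      tendsto_nhds_unique (hcont.tendsto.comp ht) (hu.tendsto ht hsin)
    linarith
  · rintro rfl
    simpa only [HasOscillation, zero_mul, sub_zero] using hu

theorem eventually_graphMap_mem {κ : Type*} {l : Filter κ} {t : κ → ℝ}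
    (hu : HasOscillation u w b) (ht : Tendsto (fun k => b + (t k)⁻¹) l (𝓝 b))
    (hs : ∀ k, Real.sin (t k) = 0) {V : Set (graph u)} (hV : IsOpen V) (hb : graphMap u b ∈ V) :
    ∀ᶠ k in l, graphMap u (b + (t k)⁻¹) ∈ V := by
  have hsnd : Tendsto (fun k => u (b + (t k)⁻¹)) l (𝓝 (u b)) := by
    simpa only [mul_zero, add_zero] using hu.tendsto ht hs
  have hlim : Tendsto (fun k => graphMap u (b + (t k)⁻¹)) l (𝓝 (graphMap u b)) :=
    tendsto_subtype_rng.2 (ht.prodMk_nhds hsnd)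
  exact hlim (hV.mem_nhds hb)

end HasOscillation

theorem tendsto_inv_natCast_mul_pi :
    Tendsto (fun k : ℕ => ((k : ℝ) * Real.pi)⁻¹) atTop (𝓝[>] 0) :=
  tendsto_inv_atTop_nhdsGT_zero.comp
    (tendsto_natCast_atTop_atTop.atTop_mul_const Real.pi_pos)

theorem bilaterallyDense_preimage_graphMap {u w : ℝ → ℝ} (hu : ∀ b, HasOscillation u (w b) b)
    {V : Set (graph u)} (hV : IsOpen V) : BilaterallyDense (graphMap u ⁻¹' V) := by
  obtain ⟨hzero, hpos⟩ := tendsto_nhdsWithin_iff.1 tendsto_inv_natCast_mul_pi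
  refine fun b hb => ⟨fun y hy => ?_, fun y hy => ?_⟩
  · have hright : Tendsto (fun k : ℕ => b + (k * Real.pi)⁻¹) atTop (𝓝 b) := by
      simpa only [add_zero] using hzero.const_add b
    have hmem := (hu b).eventually_graphMap_mem hright Real.sin_nat_mul_pi hV hb
    obtain ⟨k, hkV, hk, hky⟩ := (hmem.and (hpos.and (hright.eventually_lt_const hy))).exists
    exact ⟨_, ⟨lt_add_of_pos_right b hk, hky⟩, hkV⟩
  · have hleft : Tendsto (fun k : ℕ => b + (-(k * Real.pi))⁻¹) atTop (𝓝 b) := by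
      simpa only [inv_neg, neg_zero, add_zero] using hzero.neg.const_add b
    have hsin (k : ℕ) : Real.sin (-(k * Real.pi)) = 0 := by
      rw [Real.sin_neg, Real.sin_nat_mul_pi, neg_zero]
    have hmem := (hu b).eventually_graphMap_mem hleft hsin hV hb
    obtain ⟨k, hkV, hk, hky⟩ := (hmem.and (hpos.and (hleft.eventually_const_lt hy))).exists
    exact ⟨_, ⟨hky, add_lt_of_neg_right b (inv_neg.trans_lt (neg_lt_zero.2 hk))⟩, hkV⟩

end Oscillation

section OscillatingSum

variable {ι : Type*} {c : ι → ℝ}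

/-- The sum of the oscillations `phi (a i)` with weights `c i`; the function `g r` is the case
`c n = 1 / 2 ^ (n + 1)`, `a n = r n`. -/
noncomputable def oscillatingSum (c a : ι → ℝ) (x : ℝ) : ℝ :=
  ∑' i, c i * phi (a i) x

/-- The total weight that `oscillatingSum c a` gives to the point `b`, which the family `a` may
enumerate repeatedly. -/
noncomputable def weightAt (c a : ι → ℝ) (b : ℝ) : ℝ :=
  ∑' i : a ⁻¹' {b}, c i

theorem norm_mul_phi_le (c a x : ℝ) : ‖c * phi a x‖ ≤ |c| := by
  rw [norm_mul]
  exact mul_le_of_le_one_right (abs_nonneg c) (abs_phi_le_one a x)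

theorem summable_mul_phi (hc : Summable c) (a : ι → ℝ) (x : ℝ) :
    Summable fun i => c i * phi (a i) x :=
  hc.abs.of_norm_bounded fun _ => norm_mul_phi_le _ _ _

theorem continuousAt_oscillatingSum (hc : Summable c) {a : ι → ℝ} {b : ℝ} (hb : b ∉ range a) :
    ContinuousAt (oscillatingSum c a) b := by
  refine tendsto_tsum_of_dominated_convergence hc.abs (fun i => ?_)
    (Eventually.of_forall fun x i => norm_mul_phi_le _ _ x)
  exact ((continuousAt_phi fun h => hb ⟨i, h.symm⟩).tendsto).const_mul _

theorem hasOscillation_oscillatingSum (hc : Summable c) (a : ι → ℝ) (b : ℝ) :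
    HasOscillation (oscillatingSum c a) (weightAt c a b) b := by
  let s : Set ι := a ⁻¹' {b}
  have hsplit (x : ℝ) : oscillatingSum c a x - weightAt c a b * phi b x =
      oscillatingSum (fun i : ↑sᶜ => c i) (fun i => a i) x := by
    have hs : ∑' i : s, c i * phi (a i) x = weightAt c a b * phi b x := by
      rw [weightAt, ← tsum_mul_right]
      exact tsum_congr fun i => by rw [show a i = b from i.2]
    rw [← hs, sub_eq_iff_eq_add']
    exact ((summable_mul_phi hc a x).tsum_subtype_add_tsum_subtype_compl s).symm
  rw [HasOscillation, funext hsplit]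
  exact continuousAt_oscillatingSum (hc.subtype _) fun ⟨i, hi⟩ => i.2 hi

theorem countable_support_weightAt (hc : Summable c) (a : ι → ℝ) :
    (Function.support (weightAt c a)).Countable := by
  refine (hc.countable_support.image a).mono fun b hb => ?_
  by_contra hsupp
  refine hb ((tsum_congr fun i => ?_).trans tsum_zero)
  by_contra hi
  exact hsupp ⟨i, hi, i.2⟩

theorem dense_support_weightAt (hc : Summable c) (hpos : ∀ i, 0 < c i) {a : ι → ℝ}
    (ha : DenseRange a) : Dense (Function.support (weightAt c a)) := by
  refine ha.mono ?_
  rintro _ ⟨i, rfl⟩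
  have hsum : Summable fun j : a ⁻¹' {a i} => c j := hc.subtype _
  exact (hsum.tsum_pos (fun j => (hpos j).le) ⟨i, rfl⟩ (hpos i)).ne'

theorem setOf_not_continuousAt_oscillatingSum (hc : Summable c) (a : ι → ℝ) :
    {x | ¬ContinuousAt (oscillatingSum c a) x} = Function.support (weightAt c a) :=
  ext fun x => not_congr (hasOscillation_oscillatingSum hc a x).continuousAt_iff

theorem isDarboux_graphMap_oscillatingSum (hc : Summable c) (a : ι → ℝ) :
    IsDarboux (graphMap (oscillatingSum c a)) :=
  isDarboux_of_bilaterallyDense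
    (countable_not_continuousAt_graphMap
      (setOf_not_continuousAt_oscillatingSum hc a ▸ countable_support_weightAt hc a))
    fun _ hV => bilaterallyDense_preimage_graphMap (hasOscillation_oscillatingSum hc a) hV

theorem fSigmaMeasurable_graphMap_oscillatingSum (hc : Summable c) (a : ι → ℝ) :
    FSigmaMeasurable (graphMap (oscillatingSum c a)) :=
  fSigmaMeasurable_of_countable_not_continuousAt
    (countable_not_continuousAt_graphMap
      (setOf_not_continuousAt_oscillatingSum hc a ▸ countable_support_weightAt hc a))

theorem isPunctiform_graph_oscillatingSum (hc : Summable c) (hpos : ∀ i, 0 < c i) {a : ι → ℝ}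
    (ha : DenseRange a) : IsPunctiform (graph (oscillatingSum c a)) :=
  isPunctiform_graph_of_dense_not_continuousAt
    (setOf_not_continuousAt_oscillatingSum hc a ▸ dense_support_weightAt hc hpos ha)

end OscillatingSum

end GraphExample

theorem mainTheorem7_general {ι : Type*} {c a : ι → ℝ} (hc : Summable c) (hpos : ∀ i, 0 < c i)
    (ha : DenseRange a) :
    (∀ x : ℝ, Summable fun i => c i * GraphExample.phi (a i) x) ∧
      IsConnected (GraphExample.graph (GraphExample.oscillatingSum c a)) ∧
      GraphExample.FSigmaMeasurable (GraphExample.graphMap (GraphExample.oscillatingSum c a)) ∧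
      GraphExample.IsDarboux (GraphExample.graphMap (GraphExample.oscillatingSum c a)) ∧
      ¬ GraphExample.IsBaireOne (GraphExample.graphMap (GraphExample.oscillatingSum c a)) ∧
      GraphExample.IsPunctiform (GraphExample.graph (GraphExample.oscillatingSum c a)) ∧
      ∀ h : ℝ → GraphExample.graph (GraphExample.oscillatingSum c a), Continuous h →
        ∃ y, ∀ t, h t = y := by
  have hdarboux := GraphExample.isDarboux_graphMap_oscillatingSum hc a
  have hpunct := GraphExample.isPunctiform_graph_oscillatingSum hc hpos ha
  exact ⟨GraphExample.summable_mul_phi hc a,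
    GraphExample.isConnected_graph_of_isDarboux hdarboux,
    GraphExample.fSigmaMeasurable_graphMap_oscillatingSum hc a, hdarboux,
    GraphExample.not_isBaireOne_graphMap hpunct, hpunct,
    fun h hh => ⟨h 0, fun t => hpunct.eq_of_continuous hh t 0⟩⟩

theorem mainTheorem7 :
    (∃ (Y : Set (ℝ × ℝ)) (f : ℝ → Y), IsConnected Y ∧
      GraphExample.FSigmaMeasurable f ∧ GraphExample.IsDarboux f ∧
      ¬ GraphExample.IsBaireOne f) ∧
    ∀ r : ℕ → ℚ, Function.Surjective r →
      (∀ x : ℝ, Summable fun n : ℕ => 1 / 2 ^ (n + 1) * GraphExample.phi (r n) x) ∧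
      IsConnected (GraphExample.graph (GraphExample.g r)) ∧
      GraphExample.FSigmaMeasurable (GraphExample.graphMap (GraphExample.g r)) ∧
      GraphExample.IsDarboux (GraphExample.graphMap (GraphExample.g r)) ∧
      ¬ GraphExample.IsBaireOne (GraphExample.graphMap (GraphExample.g r)) ∧
      GraphExample.IsPunctiform (GraphExample.graph (GraphExample.g r)) ∧
      ∀ h : ℝ → GraphExample.graph (GraphExample.g r), Continuous h → ∃ c, ∀ t, h t = c := by
  have hsum : Summable fun n : ℕ => (1 : ℝ) / 2 ^ (n + 1) := by
    simpa only [one_div_pow] using (summable_nat_add_iff 1).2 summable_geometric_two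
  have hgraph (r : ℕ → ℚ) (hr : Function.Surjective r) :=
    mainTheorem7_general hsum (fun n => by positivity)
      (Rat.denseRange_cast.comp hr.denseRange Rat.continuous_coe_real)
  obtain ⟨r, hr⟩ := exists_surjective_nat ℚ
  obtain ⟨-, hconn, hmeas, hdarboux, hbaire, -⟩ := hgraph r hr
  exact ⟨⟨_, _, hconn, hmeas, hdarboux, hbaire⟩, hgraph⟩
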